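/- There is an absolute constant $c>0$, and one may take $c=2^{-3248}$, such that the following holds. Let $(X_N)_{N\ge1}$ be a sequence of bounded $\mathbb N_0$-valued random variables (not necessarily defined on the same probability space) with variances $\sigma_N^2:=\operatorname{var}(X_N)>0$, and let $\delta_N\in(0,\pi)$. Assume that for every $N$ the probability generating function $f_N(z)=\mathbb E[z^{X_N}]$, $z\in\mathbb C$, has no zeros in the sector $$S(\delta_N)=\{z\in\mathbb C\setminus\{0\}:\arg(z)\in(-\delta_N,\delta_N)\},$$ where $\arg(z)\in(-\pi,\pi]$. Let $X_N^\ast:=(X_N-\mathbb E X_N)/\sigma_N$, and let $$\kappa_m(X_N^\ast)=\frac{d^m}{dt^m}\log\mathbb E\big[e^{tX_N^\ast}\big]\Big|_{t=0}$$ be its cumulant of order $m$. Then, for all $N\ge1$ and all $m\ge3$, $$|\kappa_m(X_N^\ast)|\le\frac{m!}{(c\,\delta_N\sigma_N)^{m-2}}.$$ -/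

import Mathlib

open MeasureTheory ProbabilityTheory

/-- The probability generating function `z ↦ E[z ^ X]` of an `ℕ`-valued random variable, as a
function on the complex plane (a polynomial function when `X` is bounded). -/
noncomputable def probGenFun {Ω : Type*} [MeasurableSpace Ω] (X : Ω → ℕ) (μ : Measure Ω)
    (z : ℂ) : ℂ :=
  ∫ ω, z ^ X ω ∂μ

/-- The open sector `S(δ) = {z ≠ 0 : arg z ∈ (-δ, δ)}`, with `arg` valued in `(-π, π]`. -/
def sector (δ : ℝ) : Set ℂ :=
  {z | z ≠ 0 ∧ z.arg ∈ Set.Ioo (-δ) δ}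

/-- The cumulant of order `m` of a real random variable with exponential moments near `0`
(in particular, of a bounded one): the `m`-th derivative at `0` of `t ↦ log E[exp (t Y)]`. -/
noncomputable def cumulant {Ω : Type*} [MeasurableSpace Ω] (Y : Ω → ℝ) (μ : Measure Ω)
    (m : ℕ) : ℝ :=
  iteratedDeriv m (cgf Y μ) 0

/-- The standard deviation `σ` of an `ℕ`-valued random variable. -/
noncomputable def stdDev {Ω : Type*} [MeasurableSpace Ω] (X : Ω → ℕ) (μ : Measure Ω) : ℝ :=
  Real.sqrt (variance (fun ω => (X ω : ℝ)) μ)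

/-- The standardization `X* = (X - E X) / σ` of an `ℕ`-valued random variable. -/
noncomputable def standardization {Ω : Type*} [MeasurableSpace Ω] (X : Ω → ℕ) (μ : Measure Ω)
    (ω : Ω) : ℝ :=
  ((X ω : ℝ) - ∫ ω', (X ω' : ℝ) ∂μ) / stdDev X μ

/-!
Let `f` be the probability generating function, a polynomial with nonnegative coefficients. Without
zeros of `f` in the sector, `φ(w) = log f(e^w)` is holomorphic in the strip `|Im w| < δ`; its
derivatives at `0` are the cumulants, with `φ''(0) = σ²`. The point of the proof is that `φ'` is
*typically real* in the disc of radius `δ/2`, that is, it maps the upper half of the disc to the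
upper half plane. Rogosinski's inequality `|aₙ| rⁿ ≤ n a₁ r` for the Taylor coefficients of such a
function then bounds every cumulant by the variance; with `r = δ/4` the constant is `c = 1/4`.

That `φ'` is typically real follows from a reflection argument. For `0 < β < δ/2` the quotient
`Q(w) = f(e^{w+iβ}) / f(e^{w-iβ})` has modulus one on the real line, because `f` has real
coefficients, and modulus at most one on the line `Im w = β`, because `|f(e^{x+2iβ})| ≤ f(e^x)`.
It is bounded in between, as one sees from the linear factors of `f`, so that `|Q| ≤ 1` there by
the Phragmén–Lindelöf principle (`norm_aeval_exp_add_le`). Hence `|Q(x + it)|` has a nonpositive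
derivative in `t` at `t = 0`, and that derivative is `-2 Im φ'(x + iβ)`
(`im_logDerivExp_nonneg`). The coefficient bound is `abs_re_iteratedDeriv_le_of_typicallyReal`.
-/

section

open Complex ComplexConjugate Polynomial

/-! ### Typically real functions -/

lemma abs_sin_nat_mul_le (n : ℕ) (θ : ℝ) : |Real.sin (n * θ)| ≤ n * |Real.sin θ| := by
  induction n with
  | zero => simp
  | succ n ih =>
    have h : Real.sin (((n + 1 : ℕ) : ℝ) * θ)
        = Real.sin (n * θ) * Real.cos θ + Real.cos (n * θ) * Real.sin θ := by
      push_cast; rw [add_mul, one_mul, Real.sin_add]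
    rw [h]
    calc _ ≤ |Real.sin (n * θ)| * |Real.cos θ| + |Real.cos (n * θ)| * |Real.sin θ| := by
          rw [← abs_mul, ← abs_mul]; exact abs_add_le _ _
      _ ≤ |Real.sin (n * θ)| * 1 + 1 * |Real.sin θ| := by
          gcongr <;> exact Real.abs_cos_le_one _
      _ ≤ _ := by push_cast; linarith

/-- The Taylor coefficients of a holomorphic function, read off from its imaginary part on a
circle: the Cauchy integral of `g` against `e^{-inθ}` gives the coefficient, the one against
`e^{inθ}` vanishes, and their difference is an integral against `-2i sin nθ`. -/
theorem pow_mul_re_iteratedDeriv_eq_integral {g : ℂ → ℂ} {r : ℝ} (hr : 0 < r)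
    (hg : DifferentiableOn ℂ g (Metric.closedBall 0 r)) {n : ℕ} (hn : 1 ≤ n) :
    2 * Real.pi * (r ^ n * ((iteratedDeriv n g 0).re / n.factorial))
      = ∫ θ in (0 : ℝ)..2 * Real.pi, 2 * ((g (circleMap 0 r θ)).im * Real.sin (n * θ)) := by
  have hgc : Continuous fun θ : ℝ => g (circleMap 0 r θ) :=
    hg.continuousOn.comp_continuous (continuous_circleMap 0 r)
      fun θ => circleMap_mem_closedBall 0 hr.le θ
  have hrC : (r : ℂ) ≠ 0 := by exact_mod_cast hr.ne'
  have h1 := hg.circleIntegral_one_div_sub_center_pow_smul hr n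
  have h2 : ∮ z in C(0, r), z ^ (n - 1) * g z = 0 := by
    refine DiffContOnCl.circleIntegral_eq_zero hr.le (DifferentiableOn.diffContOnCl ?_)
    exact ((differentiable_pow _).differentiableOn.mul hg).mono Metric.closure_ball_subset_closedBall
  have e1 : ∀ θ : ℝ, deriv (circleMap 0 r) θ • ((1 / (circleMap 0 r θ - 0) ^ (n + 1)) •
      g (circleMap 0 r θ)) = I * ((r : ℂ) ^ n)⁻¹ * (exp (-(n * θ * I)) * g (circleMap 0 r θ)) := by
    intro θ
    have hz : circleMap 0 r θ = r * exp (θ * I) := by simp [circleMap]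
    have hp : exp (-(n * θ * I)) = (exp (θ * I) ^ n)⁻¹ := by
      rw [← Complex.exp_nat_mul, ← Complex.exp_neg]; ring_nf
    simp only [deriv_circleMap, smul_eq_mul, sub_zero]
    rw [hz, hp, mul_pow]
    have := Complex.exp_ne_zero (θ * I)
    field_simp
    ring
  have e2 : ∀ θ : ℝ, deriv (circleMap 0 r) θ • ((circleMap 0 r θ) ^ (n - 1) *
      g (circleMap 0 r θ)) = I * (r : ℂ) ^ n * (exp (n * θ * I) * g (circleMap 0 r θ)) := by
    intro θ
    have hz : circleMap 0 r θ = r * exp (θ * I) := by simp [circleMap]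
    have hp : exp (n * θ * I) = exp (θ * I) ^ n := by
      rw [← Complex.exp_nat_mul]; ring_nf
    simp only [deriv_circleMap, smul_eq_mul]
    rw [hz, hp]
    obtain ⟨k, rfl⟩ : ∃ k, n = k + 1 := ⟨n - 1, by omega⟩
    simp only [Nat.add_sub_cancel]
    ring
  rw [circleIntegral] at h1 h2
  simp only [e1] at h1
  simp only [e2] at h2
  rw [intervalIntegral.integral_const_mul] at h1 h2
  have h2' : ∫ θ in (0 : ℝ)..2 * Real.pi, exp (n * θ * I) * g (circleMap 0 r θ) = 0 := by
    rcases mul_eq_zero.mp h2 with h | h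
    · exact absurd h (mul_ne_zero I_ne_zero (pow_ne_zero _ hrC))
    · exact h
  have h1' : ∫ θ in (0 : ℝ)..2 * Real.pi, exp (-(n * θ * I)) * g (circleMap 0 r θ)
      = ((2 * Real.pi * (r ^ n / n.factorial) : ℝ) : ℂ) * iteratedDeriv n g 0 := by
    have hf : (n.factorial : ℂ) ≠ 0 := by exact_mod_cast n.factorial_ne_zero
    rw [smul_eq_mul] at h1
    push_cast
    have hI := I_ne_zero
    field_simp at h1 ⊢
    rw [mul_comm] at h1
    linear_combination h1
  have hc1 : Continuous fun θ : ℝ => exp (-(n * θ * I)) * g (circleMap 0 r θ) :=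
    (by fun_prop : Continuous fun θ : ℝ => exp (-(n * θ * I))).mul hgc
  have hc2 : Continuous fun θ : ℝ => exp (n * θ * I) * g (circleMap 0 r θ) :=
    (by fun_prop : Continuous fun θ : ℝ => exp (n * θ * I)).mul hgc
  have hc3 : Continuous fun θ : ℝ => exp (-(n * θ * I)) * g (circleMap 0 r θ)
      - exp (n * θ * I) * g (circleMap 0 r θ) := hc1.sub hc2
  have hsub : ∫ θ in (0 : ℝ)..2 * Real.pi,
      (exp (-(n * θ * I)) * g (circleMap 0 r θ) - exp (n * θ * I) * g (circleMap 0 r θ))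
      = ((2 * Real.pi * (r ^ n / n.factorial) : ℝ) : ℂ) * iteratedDeriv n g 0 := by
    rw [intervalIntegral.integral_sub (hc1.intervalIntegrable _ _) (hc2.intervalIntegrable _ _),
      h1', h2', sub_zero]
  have hre := congrArg Complex.re hsub
  rw [Complex.re_ofReal_mul, ← Complex.reCLM_apply,
    ← ContinuousLinearMap.intervalIntegral_comp_comm _
      (hc3.intervalIntegrable _ _)] at hre
  have e3 : ∀ θ : ℝ, Complex.reCLM (exp (-(n * θ * I)) * g (circleMap 0 r θ)
      - exp (n * θ * I) * g (circleMap 0 r θ))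
      = 2 * ((g (circleMap 0 r θ)).im * Real.sin (n * θ)) := by
    intro θ
    have a1 : exp (n * θ * I) = Real.cos (n * θ) + Real.sin (n * θ) * I := by
      rw [Complex.exp_mul_I]; push_cast; rfl
    have a2 : exp (-(n * θ * I)) = Real.cos (n * θ) - Real.sin (n * θ) * I := by
      rw [← neg_mul, Complex.exp_mul_I, Complex.cos_neg, Complex.sin_neg]; push_cast; ring
    rw [a1, a2, ← sub_mul]
    simp only [reCLM_apply, mul_re, mul_im, sub_re, sub_im, add_re, add_im, ofReal_re, ofReal_im,
      I_re, I_im]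
    ring
  simp only [e3] at hre
  rw [hre]
  ring

/-- **Rogosinski's coefficient bound** for typically real functions: if `g` is real on the real
axis and maps the closed upper half disc to the closed upper half plane, then its Taylor
coefficients satisfy `|aₙ| rⁿ ≤ n a₁ r`. Indeed `Im g · sin θ ≥ 0` on the circle of radius `r`, so
that `|Im g · sin nθ| ≤ n Im g · sin θ` there. -/
theorem abs_re_iteratedDeriv_le_of_typicallyReal {g : ℂ → ℂ} {r : ℝ} (hr : 0 < r)
    (hg : DifferentiableOn ℂ g (Metric.closedBall 0 r))
    (hconj : ∀ z, g (conj z) = conj (g z))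
    (hpos : ∀ z ∈ Metric.closedBall (0 : ℂ) r, 0 ≤ z.im → 0 ≤ (g z).im) {n : ℕ} (hn : 1 ≤ n) :
    r ^ n * (|(iteratedDeriv n g 0).re| / n.factorial) ≤ n * (r * (deriv g 0).re) := by
  have hgc : Continuous fun θ : ℝ => g (circleMap 0 r θ) :=
    hg.continuousOn.comp_continuous (continuous_circleMap 0 r)
      fun θ => circleMap_mem_closedBall 0 hr.le θ
  have hgi : Continuous fun θ : ℝ => (g (circleMap 0 r θ)).im := Complex.continuous_im.comp hgc
  have hn' := pow_mul_re_iteratedDeriv_eq_integral hr hg hn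
  have h1' := pow_mul_re_iteratedDeriv_eq_integral hr hg le_rfl
  simp only [iteratedDeriv_one, pow_one, Nat.factorial_one, Nat.cast_one, div_one, one_mul] at h1'
  have him : ∀ θ : ℝ, (circleMap 0 r θ).im = r * Real.sin θ := by
    intro θ
    rw [circleMap, zero_add, Complex.im_ofReal_mul, Complex.exp_ofReal_mul_I_im]
  have hsign : ∀ θ : ℝ, |(g (circleMap 0 r θ)).im| * |Real.sin θ|
      = (g (circleMap 0 r θ)).im * Real.sin θ := by
    intro θ
    rw [← abs_mul, abs_eq_self]
    have hmem : circleMap 0 r θ ∈ Metric.closedBall (0 : ℂ) r := circleMap_mem_closedBall 0 hr.le θ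
    rcases le_total 0 (Real.sin θ) with h | h
    · exact mul_nonneg (hpos _ hmem (by rw [him]; positivity)) h
    · have h3 := hpos (conj (circleMap 0 r θ)) (by simpa using hmem)
        (by rw [conj_im, him]; nlinarith)
      rw [hconj, conj_im] at h3
      exact mul_nonneg_of_nonpos_of_nonpos (by linarith) h
  have key : |∫ θ in (0 : ℝ)..2 * Real.pi, 2 * ((g (circleMap 0 r θ)).im * Real.sin (n * θ))|
      ≤ ∫ θ in (0 : ℝ)..2 * Real.pi, n * (2 * ((g (circleMap 0 r θ)).im * Real.sin θ)) := by
    rw [← Real.norm_eq_abs]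
    refine intervalIntegral.norm_integral_le_of_norm_le (by positivity)
      (Filter.Eventually.of_forall fun θ _ => ?_)
      (Continuous.intervalIntegrable (by fun_prop) _ _)
    rw [Real.norm_eq_abs, abs_mul, abs_mul, abs_two, ← hsign θ]
    have := mul_le_mul_of_nonneg_left (abs_sin_nat_mul_le n θ) (abs_nonneg (g (circleMap 0 r θ)).im)
    linarith
  rw [intervalIntegral.integral_const_mul (n : ℝ), ← h1', ← hn', abs_mul (2 * Real.pi), abs_mul (r ^ n),
    abs_div, abs_of_pos Real.two_pi_pos, abs_of_pos (pow_pos hr n), Nat.abs_cast] at key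
  have hp := Real.two_pi_pos
  have : 2 * Real.pi * (r ^ n * (|(iteratedDeriv n g 0).re| / n.factorial))
      ≤ 2 * Real.pi * (n * (r * (deriv g 0).re)) := by linarith
  exact le_of_mul_le_mul_left this hp

/-! ### Polynomials without zeros in a sector -/

lemma norm_sq_exp_sub (v ζ : ℂ) : ‖exp v - ζ‖ ^ 2
    = Real.exp v.re ^ 2 + ‖ζ‖ ^ 2 - 2 * (Real.exp v.re * ‖ζ‖ * Real.cos (v.im - ζ.arg)) := by
  have hre : ζ.re = ‖ζ‖ * Real.cos ζ.arg := (Complex.norm_mul_cos_arg ζ).symm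
  have him : ζ.im = ‖ζ‖ * Real.sin ζ.arg := (Complex.norm_mul_sin_arg ζ).symm
  rw [Complex.sq_norm, Complex.normSq_apply, sub_re, sub_im, Complex.exp_re, Complex.exp_im,
    hre, him, Real.cos_sub]
  have h1 := Real.sin_sq_add_cos_sq v.im
  have h2 := Real.sin_sq_add_cos_sq ζ.arg
  linear_combination (Real.exp v.re) ^ 2 * h1 + ‖ζ‖ ^ 2 * h2

/-- The factors of a polynomial without zeros in a sector: for `v` in a smaller strip, `|e^v - ζ|`
is comparable to `|e^v| + |ζ|`, since the directions of `e^v` and `ζ` differ by an angle at least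
`β`. -/
lemma norm_exp_sub_le_of_notMem_sector {δ β : ℝ} (hβ : 0 < β) (hβδ : 2 * β ≤ δ) (hδ : δ < Real.pi)
    {ζ : ℂ} (hζ : ζ ∉ sector δ) {v v' : ℂ} (hre : v'.re = v.re) (him : |v.im| ≤ β) :
    ‖exp v' - ζ‖ ≤ √(2 / (1 - Real.cos β)) * ‖exp v - ζ‖ := by
  have hc : Real.cos β < 1 := by
    rw [← Real.cos_zero]
    exact Real.cos_lt_cos_of_nonneg_of_le_pi le_rfl (by linarith) hβ
  have hc0 := Real.neg_one_le_cos β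
  have hc1 : 0 < 1 - Real.cos β := by linarith
  -- by the law of cosines, both sides are comparable to `|e^v| ^ 2 + |ζ| ^ 2`
  suffices h : (1 - Real.cos β) * ‖exp v' - ζ‖ ^ 2 ≤ 2 * ‖exp v - ζ‖ ^ 2 by
    rw [← Real.sqrt_sq (norm_nonneg (exp v - ζ)), ← Real.sqrt_mul (by positivity)]
    apply Real.le_sqrt_of_sq_le
    rw [div_mul_eq_mul_div, le_div_iff₀ hc1]
    linarith
  rw [norm_sq_exp_sub, norm_sq_exp_sub, hre]
  have he := Real.exp_pos v.re
  have hz := norm_nonneg ζ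
  set e := Real.exp v.re
  have hez : 0 ≤ e * ‖ζ‖ := by positivity
  have hnum : e ^ 2 + ‖ζ‖ ^ 2 - 2 * (e * ‖ζ‖ * Real.cos (v'.im - ζ.arg))
      ≤ 2 * (e ^ 2 + ‖ζ‖ ^ 2) := by
    nlinarith [Real.neg_one_le_cos (v'.im - ζ.arg), sq_nonneg (e - ‖ζ‖)]
  have hden : e * ‖ζ‖ * Real.cos (v.im - ζ.arg) ≤ e * ‖ζ‖ * Real.cos β := by
    by_cases h0 : ζ = 0
    · simp [h0]
    refine mul_le_mul_of_nonneg_left ?_ hez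
    have harg : δ ≤ |ζ.arg| := by
      by_contra! h
      exact hζ ⟨h0, abs_lt.mp h⟩
    have hpi := Complex.abs_arg_le_pi ζ
    rw [← Real.cos_abs (v.im - ζ.arg)]
    have hlow : β ≤ |v.im - ζ.arg| := by
      have := abs_sub_abs_le_abs_sub ζ.arg v.im
      rw [abs_sub_comm] at this
      linarith
    have hup : |v.im - ζ.arg| ≤ 2 * Real.pi - β := by
      have := abs_sub v.im ζ.arg
      linarith
    rcases le_total |v.im - ζ.arg| Real.pi with h | h
    · exact Real.cos_le_cos_of_nonneg_of_le_pi hβ.le h hlow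
    · rw [← Real.cos_two_pi_sub]
      exact Real.cos_le_cos_of_nonneg_of_le_pi hβ.le (by linarith) (by linarith)
  have hcos : 0 ≤ Real.cos β :=
    Real.cos_nonneg_of_neg_pi_div_two_le_of_le (by linarith) (by linarith)
  nlinarith [mul_le_mul_of_nonneg_left hnum hc1.le, mul_nonneg hcos (sq_nonneg (e - ‖ζ‖))]

lemma exists_norm_eval_exp_le {q : ℂ[X]} {δ β : ℝ} (hβ : 0 < β) (hβδ : 2 * β ≤ δ)
    (hδ : δ < Real.pi) (hq : ∀ z ∈ sector δ, q.eval z ≠ 0) :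
    ∃ B, ∀ v v' : ℂ, v'.re = v.re → |v.im| ≤ β → ‖q.eval (exp v')‖ ≤ B * ‖q.eval (exp v)‖ := by
  set K := √(2 / (1 - Real.cos β))
  refine ⟨K ^ Multiset.card q.roots, fun v v' hre him => ?_⟩
  have key : ∀ s : Multiset ℂ, (∀ ζ ∈ s, ζ ∉ sector δ) →
      ‖(s.map fun ζ => exp v' - ζ).prod‖
        ≤ K ^ Multiset.card s * ‖(s.map fun ζ => exp v - ζ).prod‖ := by
    intro s
    induction s using Multiset.induction with
    | empty => simp
    | cons a s ih =>
      intro hs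
      have h1 := norm_exp_sub_le_of_notMem_sector hβ hβδ hδ (hs a (Multiset.mem_cons_self a s))
        hre him
      have h2 := ih fun ζ hζ => hs ζ (Multiset.mem_cons_of_mem hζ)
      simp only [Multiset.map_cons, Multiset.prod_cons, norm_mul, Multiset.card_cons]
      calc _ ≤ (K * ‖exp v - a‖) *
            (K ^ Multiset.card s * ‖(s.map fun ζ => exp v - ζ).prod‖) := by gcongr
        _ = _ := by ring
  have hroots : ∀ ζ ∈ q.roots, ζ ∉ sector δ := fun ζ hζ hmem =>
    hq ζ hmem (Polynomial.isRoot_of_mem_roots hζ)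
  have := key q.roots hroots
  rw [(IsAlgClosed.splits q).eval_eq_prod_roots, (IsAlgClosed.splits q).eval_eq_prod_roots,
    norm_mul, norm_mul]
  calc _ ≤ ‖q.leadingCoeff‖ * (K ^ Multiset.card q.roots *
        ‖(q.roots.map fun ζ => exp v - ζ).prod‖) := by gcongr
    _ = _ := by ring

lemma exp_mem_sector {δ : ℝ} (hδ : δ < Real.pi) {w : ℂ} (hw : |w.im| < δ) : exp w ∈ sector δ := by
  obtain ⟨h1, h2⟩ := abs_lt.mp hw
  refine ⟨Complex.exp_ne_zero w, ?_⟩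
  rw [Complex.arg_exp, toIocMod_eq_self _ |>.mpr]
  · exact ⟨h1, h2⟩
  · constructor <;> linarith

/-! ### The logarithmic derivative on the strip -/

section

variable (p : ℝ[X])

/-- The derivative `e^w p'(e^w) / p(e^w)` of `w ↦ log p(e^w)`, with no choice of a logarithm. It
takes the junk value `0` where `p(e^w) = 0`. -/
noncomputable def logDerivExp (w : ℂ) : ℂ :=
  exp w * aeval (exp w) (derivative p) / aeval (exp w) p

lemma logDerivExp_conj (w : ℂ) : logDerivExp p (conj w) = conj (logDerivExp p w) := by
  simp only [logDerivExp, Complex.exp_conj, Polynomial.aeval_conj, map_div₀, map_mul]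

lemma hasDerivAt_aeval_exp (w : ℂ) :
    HasDerivAt (fun w => aeval (exp w) p) (exp w * aeval (exp w) (derivative p)) w := by
  have := (Polynomial.hasDerivAt_aeval p (exp w)).comp w (Complex.hasDerivAt_exp w)
  rwa [mul_comm] at this

lemma differentiable_aeval_exp : Differentiable ℂ fun w => aeval (exp w) p :=
  fun w => (hasDerivAt_aeval_exp p w).differentiableAt

lemma aeval_ofReal_eq_eval (x : ℝ) : aeval (x : ℂ) p = ((p.eval x : ℝ) : ℂ) :=
  Polynomial.aeval_algebraMap_apply_eq_algebraMap_eval x p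

/-- A polynomial with nonnegative coefficients is largest, on each circle around the origin, at the
positive real point. -/
lemma norm_aeval_exp_le (hp : ∀ k, 0 ≤ p.coeff k) (w : ℂ) :
    ‖aeval (exp w) p‖ ≤ ‖aeval (exp (w.re : ℂ)) p‖ := by
  have h1 : aeval (exp (w.re : ℂ)) p = ((p.eval (Real.exp w.re) : ℝ) : ℂ) := by
    rw [← Complex.ofReal_exp, aeval_ofReal_eq_eval]
  rw [h1, Complex.norm_real, Polynomial.aeval_eq_sum_range, Polynomial.eval_eq_sum_range]
  refine (norm_sum_le _ _).trans (le_trans (Finset.sum_le_sum fun i _ => ?_) (le_abs_self _))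
  rw [norm_smul, norm_pow, Complex.norm_exp, Real.norm_of_nonneg (hp i)]
end

variable {p : ℝ[X]} {δ : ℝ}

lemma aeval_exp_ne_zero (hδ : δ < Real.pi) (hz : ∀ z ∈ sector δ, aeval z p ≠ 0) {w : ℂ}
    (hw : |w.im| < δ) : aeval (exp w) p ≠ 0 := hz _ (exp_mem_sector hδ hw)

lemma differentiableOn_logDerivExp (hδ : δ < Real.pi) (hz : ∀ z ∈ sector δ, aeval z p ≠ 0) :
    DifferentiableOn ℂ (logDerivExp p) {w | |w.im| < δ} := by
  refine DifferentiableOn.div ?_ (differentiable_aeval_exp p).differentiableOn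
    fun w hw => aeval_exp_ne_zero hδ hz hw
  exact (Complex.differentiable_exp.mul (differentiable_aeval_exp _)).differentiableOn

/-- Of two points of the zero-free strip symmetric about the line `Im = β`, the upper one has the
smaller value of `|p(e^·)|`; the lower one appears here through its conjugate `w - iβ`. By the
Phragmén–Lindelöf principle it suffices to compare on the two lines bounding the strip
`0 ≤ Im w ≤ β`: on the lower one the two values are complex conjugate, and on the upper one the
denominator is the value at a positive real point. -/
theorem norm_aeval_exp_add_le (hδ : δ < Real.pi)
    (hp : ∀ k, 0 ≤ p.coeff k) (hz : ∀ z ∈ sector δ, aeval z p ≠ 0) {β : ℝ} (hβ : 0 < β)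
    (hβδ : 2 * β < δ) {w : ℂ} (h0 : 0 ≤ w.im) (h1 : w.im ≤ β) :
    ‖aeval (exp (w + β * I)) p / aeval (exp (w - β * I)) p‖ ≤ 1 := by
  obtain ⟨B, hB⟩ := exists_norm_eval_exp_le (q := p.map (algebraMap ℝ ℂ)) hβ hβδ.le hδ
    (fun z h => by rw [Polynomial.eval_map_algebraMap]; exact hz z h)
  simp only [Polynomial.eval_map_algebraMap] at hB
  have hne : ∀ w : ℂ, 0 ≤ w.im → w.im ≤ β → aeval (exp (w - β * I)) p ≠ 0 := by
    intro w h0 h1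
    refine aeval_exp_ne_zero hδ hz ?_
    rw [abs_lt]
    constructor <;> simp <;> linarith
  refine PhragmenLindelof.horizontal_strip (a := 0) (b := β) (C := 1)
    (f := fun w => aeval (exp (w + β * I)) p / aeval (exp (w - β * I)) p) ?_ ?_ ?_ ?_ h0 h1
  · refine DifferentiableOn.diffContOnCl ?_
    have hcl : closure (im ⁻¹' Set.Ioo 0 β) ⊆ im ⁻¹' Set.Icc 0 β :=
      closure_minimal (Set.preimage_mono Set.Ioo_subset_Icc_self)
        (isClosed_Icc.preimage Complex.continuous_im)
    refine DifferentiableOn.mono (DifferentiableOn.div ?_ ?_ fun w hw => hne w hw.1 hw.2) hcl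
    · exact ((differentiable_aeval_exp p).comp (differentiable_id.add_const _)).differentiableOn
    · exact ((differentiable_aeval_exp p).comp (differentiable_id.sub_const _)).differentiableOn
  · refine ⟨0, by rw [sub_zero]; positivity, 0, ?_⟩
    refine Asymptotics.IsBigO.of_bound B ?_
    filter_upwards [Filter.mem_inf_of_right (Filter.mem_principal_self _)] with w hw
    have hw' := hne w hw.1.le hw.2.le
    simp only [zero_mul, Real.exp_zero, norm_one, mul_one, norm_div]
    rw [div_le_iff₀ (norm_pos_iff.mpr hw')]
    refine hB _ _ (by simp) ?_
    obtain ⟨h3, h4⟩ := hw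
    rw [abs_le]
    constructor <;> simp <;> linarith
  · intro w hw
    have hc : w - β * I = conj (w + β * I) := by
      apply Complex.ext <;> simp [hw]
    rw [hc, Complex.exp_conj, Polynomial.aeval_conj, norm_div, Complex.norm_conj]
    exact div_self_le_one _
  · intro w hw
    have hc : w - β * I = w.re := by
      apply Complex.ext <;> simp [hw]
    rw [norm_div, hc]
    refine div_le_one_of_le₀ ?_ (norm_nonneg _)
    have := norm_aeval_exp_le p hp (w + β * I)
    simpa using this

/-- The function `|p(e^{x+iy})|` does not increase in `y` for `0 ≤ y < δ/2`, expressed through the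
imaginary part of the logarithmic derivative. This is the infinitesimal form of
`norm_aeval_exp_add_le` at the line of reflection. -/
theorem im_logDerivExp_nonneg (hδ : δ < Real.pi)
    (hp : ∀ k, 0 ≤ p.coeff k) (hz : ∀ z ∈ sector δ, aeval z p ≠ 0) {w : ℂ}
    (h0 : 0 ≤ w.im) (hw : 2 * w.im < δ) : 0 ≤ (logDerivExp p w).im := by
  rcases h0.eq_or_lt with h0 | hβ
  · have hc : conj w = w := Complex.conj_eq_iff_im.mpr h0.symm
    have := logDerivExp_conj p w
    rw [hc] at this
    exact (Complex.conj_eq_iff_im.mp this.symm).ge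
  set β := w.im with hβdef
  set x : ℝ := w.re with hx
  have hwx : w = x + β * I := (Complex.re_add_im w).symm
  have hwx' : conj w = x - β * I := by
    rw [hwx]; simp [sub_eq_add_neg]
  set A := aeval (exp w) p with hA
  have hA0 : A ≠ 0 := aeval_exp_ne_zero hδ hz (by rw [← hβdef, abs_of_pos hβ]; linarith)
  set Q : ℂ → ℂ := fun u => aeval (exp (u + β * I)) p / aeval (exp (u - β * I)) p with hQ
  have hcA : aeval (exp (x - β * I)) p = conj A := by
    rw [← hwx', Complex.exp_conj, Polynomial.aeval_conj]
  have hcA0 : conj A ≠ 0 := by simpa using hA0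
  have hQx : Q x = A / conj A := by simp only [hQ]; rw [hcA, ← hwx]
  have hQd : HasDerivAt Q (Q x * (logDerivExp p w - conj (logDerivExp p w))) x := by
    have d1 : HasDerivAt (fun u : ℂ => aeval (exp (u + β * I)) p)
        (exp w * aeval (exp w) (derivative p)) x := by
      have := hasDerivAt_aeval_exp p (x + β * I)
      rw [← hwx] at this
      rw [hwx] at this ⊢
      exact this.comp_add_const _ _
    have d2 : HasDerivAt (fun u : ℂ => aeval (exp (u - β * I)) p)
        (conj (exp w * aeval (exp w) (derivative p))) x := by
      have := (hasDerivAt_aeval_exp p (x - β * I)).comp_sub_const _ _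
      rw [← hwx', Complex.exp_conj, Polynomial.aeval_conj, ← map_mul] at this
      exact this
    have d := d1.div d2 (by rw [hcA]; exact hcA0)
    refine d.congr_deriv ?_
    rw [hQx, hcA, logDerivExp, ← hA, ← hwx, ← hA, map_div₀, map_mul]
    field_simp
  -- the curve `t ↦ Q (x + t i)` starts on the unit circle and stays in the closed unit disc
  have hline : HasDerivAt (fun t : ℝ => (x : ℂ) + t * I) I 0 := by
    simpa using ((Complex.ofRealCLM.hasDerivAt (x := (0 : ℝ))).mul_const I).const_add (x : ℂ)
  have hcurve : HasDerivAt (fun t : ℝ => Q (x + t * I))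
      (Q x * (logDerivExp p w - conj (logDerivExp p w)) * I) 0 := by
    have h := HasDerivAt.comp (h₂ := Q) (0 : ℝ) (by simpa using hQd) hline
    exact h
  have hnsq := hcurve.norm_sq
  have hnQx : ‖Q x‖ = 1 := by
    rw [hQx, norm_div, Complex.norm_conj, div_self (norm_ne_zero_iff.mpr hA0)]
  have hQ0 : Q (x + (0 : ℝ) * I) = Q x := by simp
  by_contra! hneg
  set l := logDerivExp p w with hl
  have hval : 2 * inner ℝ (Q (x + (0 : ℝ) * I)) (Q x * (l - conj l) * I) = -4 * l.im := by
    have e : Q x * (l - conj l) * I = ((-2 * l.im : ℝ) : ℂ) * Q x := by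
      rw [Complex.sub_conj]; push_cast
      linear_combination (2 * l.im * Q x) * Complex.I_mul_I
    rw [hQ0, e, ← Complex.real_smul, inner_smul_right, real_inner_self_eq_norm_sq, hnQx]
    ring
  rw [hval] at hnsq
  have hev := (hasDerivAt_iff_tendsto_slope.mp hnsq).mono_left (nhdsGT_le_nhdsNE (0 : ℝ))
  have hle : -4 * l.im ≤ 0 := by
    refine le_of_tendsto hev ?_
    filter_upwards [Ioo_mem_nhdsGT hβ] with t ht
    have hb : ‖Q (x + t * I)‖ ≤ 1 :=
      norm_aeval_exp_add_le hδ hp hz hβ hw (by simpa using ht.1.le) (by simpa using ht.2.le)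
    rw [slope_def_field, hQ0, hnQx, sub_zero]
    refine div_nonpos_of_nonpos_of_nonneg ?_ ht.1.le
    have := pow_le_one₀ (n := 2) (norm_nonneg _) hb
    linarith
  linarith

/-! ### Derivatives at the origin -/

lemma iteratedDeriv_re_comp_ofReal {g : ℂ → ℂ} {U : Set ℂ} (hU : IsOpen U)
    (hRU : ∀ t : ℝ, (t : ℂ) ∈ U) (hg : DifferentiableOn ℂ g U) (n : ℕ) :
    iteratedDeriv n (fun t : ℝ => (g t).re) = fun t : ℝ => (iteratedDeriv n g t).re := by
  have hd : ∀ k, DifferentiableOn ℂ (iteratedDeriv k g) U := by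
    intro k
    induction k with
    | zero => simpa using hg
    | succ k ih => rw [iteratedDeriv_succ]; exact ih.deriv hU
  induction n with
  | zero => simp
  | succ n ih =>
    funext t
    rw [iteratedDeriv_succ, ih, iteratedDeriv_succ]
    exact (((hd n).differentiableAt (hU.mem_nhds (hRU t))).hasDerivAt.real_of_complex).deriv

lemma deriv_log_eval_exp (hpos : ∀ t : ℝ, 0 < p.eval (Real.exp t)) :
    deriv (fun t => Real.log (p.eval (Real.exp t))) = fun t : ℝ => (logDerivExp p t).re := by
  funext t
  have h1 := ((p.hasDerivAt (Real.exp t)).comp t (Real.hasDerivAt_exp t)).log (hpos t).ne'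
  refine h1.deriv.trans ?_
  have h2 : logDerivExp p t
      = ((Real.exp t * (derivative p).eval (Real.exp t) / p.eval (Real.exp t) : ℝ) : ℂ) := by
    rw [logDerivExp, ← Complex.ofReal_exp, aeval_ofReal_eq_eval, aeval_ofReal_eq_eval]
    push_cast
    rfl
  rw [h2, Complex.ofReal_re, mul_comm]
  rfl

/-- The cumulant bound in terms of polynomials: `logDerivExp p` is typically real in the disc of
radius `δ/4`, and its Taylor coefficients are the derivatives of `t ↦ log p(e^t)` up to
factorials. -/
theorem abs_iteratedDeriv_log_eval_exp_le (hδ0 : 0 < δ) (hδ : δ < Real.pi)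
    (hp : ∀ k, 0 ≤ p.coeff k) (hz : ∀ z ∈ sector δ, aeval z p ≠ 0)
    (hpos : ∀ t : ℝ, 0 < p.eval (Real.exp t)) {m : ℕ} (hm : 2 ≤ m) :
    |iteratedDeriv m (fun t => Real.log (p.eval (Real.exp t))) 0| * (1 / 4 * δ) ^ (m - 2)
      ≤ m.factorial * iteratedDeriv 2 (fun t => Real.log (p.eval (Real.exp t))) 0 := by
  obtain ⟨n, rfl⟩ : ∃ n, m = n + 2 := ⟨m - 2, by omega⟩
  have hU : IsOpen {w : ℂ | |w.im| < δ} :=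
    isOpen_lt (continuous_abs.comp Complex.continuous_im) continuous_const
  have hg := differentiableOn_logDerivExp hδ hz
  have hit : ∀ k, iteratedDeriv (k + 1) (fun t => Real.log (p.eval (Real.exp t))) 0
      = (iteratedDeriv k (logDerivExp p) 0).re := by
    intro k
    rw [iteratedDeriv_succ', deriv_log_eval_exp hpos,
      iteratedDeriv_re_comp_ofReal hU (fun t => by simpa using hδ0) hg k]
    simp
  set r := 1 / 4 * δ with hr
  have hr0 : 0 < r := by positivity
  have him : ∀ z ∈ Metric.closedBall (0 : ℂ) r, |z.im| ≤ r := fun z hz =>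
    (Complex.abs_im_le_norm z).trans (by simpa using hz)
  have key := abs_re_iteratedDeriv_le_of_typicallyReal hr0
    (hg.mono fun z hz => (him z hz).trans_lt (by rw [hr]; linarith))
    (logDerivExp_conj p)
    (fun z hzb h0 => im_logDerivExp_nonneg hδ hp hz h0
      (by have := (le_abs_self _).trans (him z hzb); rw [hr] at this; linarith))
    (n := n + 1) (by omega)
  have h2 := hit 1
  rw [iteratedDeriv_one] at h2
  rw [hit (n + 1), h2, Nat.add_sub_cancel]
  have hκ : 0 ≤ (deriv (logDerivExp p) 0).re := by
    have : 0 ≤ ((n + 1 : ℕ) : ℝ) * (r * (deriv (logDerivExp p) 0).re) :=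
      le_trans (by positivity) key
    exact nonneg_of_mul_nonneg_right (nonneg_of_mul_nonneg_right this (by positivity)) hr0
  set a := |(iteratedDeriv (n + 1) (logDerivExp p) 0).re|
  set κ := (deriv (logDerivExp p) 0).re
  have hf : (0 : ℝ) < (n + 1).factorial := by exact_mod_cast Nat.factorial_pos _
  rw [mul_div_assoc', div_le_iff₀ hf] at key
  have key2 : a * r ^ n ≤ (n + 1 : ℕ) * κ * (n + 1).factorial := by
    refine le_of_mul_le_mul_left ?_ hr0
    calc r * (a * r ^ n) = r ^ (n + 1) * a := by ring
      _ ≤ _ := key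
      _ = _ := by ring
  refine key2.trans ?_
  rw [Nat.factorial_succ (n + 1)]
  push_cast
  nlinarith [mul_nonneg hκ hf.le]

/-! ### Generating functions and cumulants of bounded random variables -/

theorem exists_polynomial_probGenFun {Ω : Type*} [MeasurableSpace Ω] {μ : Measure Ω}
    [IsProbabilityMeasure μ] {X : Ω → ℕ} (hX : Measurable X) {n : ℕ} (hn : ∀ᵐ ω ∂μ, X ω ≤ n) :
    ∃ p : ℝ[X], (∀ k, 0 ≤ p.coeff k) ∧ (∀ z : ℂ, probGenFun X μ z = aeval z p) ∧
      ∀ t, mgf (fun ω => (X ω : ℝ)) μ t = p.eval (Real.exp t) := by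
  set p : ℝ[X] := ∑ k ∈ Finset.range (n + 1), C (μ.real (X ⁻¹' {k})) * Polynomial.X ^ k
  have hpgf : ∀ z : ℂ, probGenFun X μ z = aeval z p := by
    intro z
    have hae : (fun ω => z ^ X ω) =ᵐ[μ] fun ω => ∑ k ∈ Finset.range (n + 1),
        (X ⁻¹' {k}).indicator (fun _ => z ^ k) ω := by
      filter_upwards [hn] with ω hω
      rw [Finset.sum_eq_single (X ω)]
      · simp
      · intro k _ hk
        exact Set.indicator_of_notMem (fun h => hk h.symm) _
      · intro h
        exact absurd (Finset.mem_range.mpr (Nat.lt_succ_of_le hω)) h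
    have hm : ∀ k, MeasurableSet (X ⁻¹' {k}) := fun k => hX (measurableSet_singleton k)
    rw [probGenFun, integral_congr_ae hae, integral_finsetSum]
    · simp only [p, map_sum, map_mul, aeval_C, map_pow, aeval_X]
      refine Finset.sum_congr rfl fun k _ => ?_
      rw [integral_indicator_const _ (hm k), Complex.real_smul]
      rfl
    · intro k _
      exact (integrable_const _).indicator (hm k)
  refine ⟨p, fun k => ?_, hpgf, fun t => ?_⟩
  · simp only [p, finsetSum_coeff, coeff_C_mul, coeff_X_pow]
    exact Finset.sum_nonneg fun i _ => mul_nonneg measureReal_nonneg (by split_ifs <;> simp)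
  · have h := hpgf (Real.exp t)
    rw [aeval_ofReal_eq_eval] at h
    have h2 : probGenFun X μ (Real.exp t) = ((mgf (fun ω => (X ω : ℝ)) μ t : ℝ) : ℂ) := by
      rw [probGenFun, mgf, ← integral_complex_ofReal]
      congr 1
      funext ω
      rw [← Complex.ofReal_pow, ← Real.exp_nat_mul, mul_comm]
    rw [h2] at h
    exact_mod_cast h

theorem cumulant_standardization {Ω : Type*} [MeasurableSpace Ω] {μ : Measure Ω}
    [IsProbabilityMeasure μ] {X : Ω → ℕ} (hc : ContDiff ℝ ⊤ (cgf (fun ω => (X ω : ℝ)) μ))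
    (hint : ∀ t, Integrable (fun ω => Real.exp (t * (X ω : ℝ))) μ)
    {m : ℕ} (hm : 2 ≤ m) :
    cumulant (standardization X μ) μ m
      = (stdDev X μ)⁻¹ ^ m * iteratedDeriv m (cgf (fun ω => (X ω : ℝ)) μ) 0 := by
  set σ := stdDev X μ
  set e := ∫ ω', (X ω' : ℝ) ∂μ
  have hcgf : cgf (standardization X μ) μ
      = fun t => cgf (fun ω => (X ω : ℝ)) μ (σ⁻¹ * t) - e * σ⁻¹ * t := by
    funext t
    have hm : mgf (standardization X μ) μ t
        = mgf (fun ω => (X ω : ℝ)) μ (σ⁻¹ * t) * Real.exp (-(e * σ⁻¹ * t)) := by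
      rw [mgf, mgf, ← integral_mul_const]
      congr 1
      funext ω
      change Real.exp (t * (((X ω : ℝ) - e) / σ)) = _
      rw [← Real.exp_add]
      congr 1
      rw [div_eq_mul_inv]
      ring
    rw [cgf, cgf, hm, Real.log_mul (mgf_pos (hint _)).ne' (Real.exp_ne_zero _), Real.log_exp]
    ring
  have hsm : ContDiff ℝ m (cgf (fun ω => (X ω : ℝ)) μ) := hc.of_le (by exact_mod_cast le_top)
  rw [cumulant, hcgf, iteratedDeriv_fun_sub, iteratedDeriv_comp_const_mul hsm,
    iteratedDeriv_const_mul_field, iteratedDeriv_fun_id]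
  · simp [show m ≠ 0 by omega, show m ≠ 1 by omega]
  · exact (hsm.comp (contDiff_const.mul contDiff_id)).contDiffAt
  · exact (contDiff_const.mul contDiff_id).contDiffAt

lemma integrable_exp_mul_of_ae_le {Ω : Type*} [MeasurableSpace Ω] {μ : Measure Ω}
    [IsProbabilityMeasure μ] {X : Ω → ℕ} (hX : Measurable X) {n : ℕ} (hn : ∀ᵐ ω ∂μ, X ω ≤ n)
    (t : ℝ) : Integrable (fun ω => Real.exp (t * (X ω : ℝ))) μ := by
  refine integrable_exp_mul_of_mem_Icc (a := 0) (b := n)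
    (measurable_from_top.comp hX).aemeasurable ?_
  filter_upwards [hn] with ω hω
  exact ⟨Nat.cast_nonneg _, by exact_mod_cast hω⟩

theorem abs_cumulant_standardization_le {Ω : Type*} [MeasurableSpace Ω] {μ : Measure Ω}
    [IsProbabilityMeasure μ] {X : Ω → ℕ} (hX : Measurable X) (hn : ∃ n : ℕ, ∀ᵐ ω ∂μ, X ω ≤ n)
    (hvar : 0 < variance (fun ω => (X ω : ℝ)) μ) {δ : ℝ} (hδ : δ ∈ Set.Ioo 0 Real.pi)
    (hz : ∀ z ∈ sector δ, probGenFun X μ z ≠ 0) {m : ℕ} (hm : 2 ≤ m) :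
    |cumulant (standardization X μ) μ m|
      ≤ m.factorial / (1 / 4 * δ * stdDev X μ) ^ (m - 2) := by
  obtain ⟨n, hn⟩ := hn
  obtain ⟨p, hp, hpgf, hmgf⟩ := exists_polynomial_probGenFun hX hn
  have hint := integrable_exp_mul_of_ae_le hX hn
  have hpos : ∀ t : ℝ, 0 < p.eval (Real.exp t) := fun t => hmgf t ▸ mgf_pos (hint t)
  have hcgf : cgf (fun ω => (X ω : ℝ)) μ = fun t => Real.log (p.eval (Real.exp t)) := by
    funext t; rw [cgf, hmgf]
  have hsmooth : ContDiff ℝ ⊤ (cgf (fun ω => (X ω : ℝ)) μ) := by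
    rw [hcgf]
    exact ((Polynomial.contDiff_aeval p ⊤).comp Real.contDiff_exp).log fun t => (hpos t).ne'
  have hmem : (0 : ℝ) ∈ interior (integrableExpSet (fun ω => (X ω : ℝ)) μ) := by
    rw [show integrableExpSet (fun ω => (X ω : ℝ)) μ = Set.univ from Set.eq_univ_of_forall hint]
    simp
  have hκ2 : iteratedDeriv 2 (cgf (fun ω => (X ω : ℝ)) μ) 0 = stdDev X μ ^ 2 := by
    rw [← variance_tilted_mul hmem, stdDev, Real.sq_sqrt hvar.le]
    simp
  have hσ : 0 < stdDev X μ := Real.sqrt_pos.mpr hvar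
  have key := abs_iteratedDeriv_log_eval_exp_le hδ.1 hδ.2 hp (fun z h => hpgf z ▸ hz z h) hpos hm
  rw [← hcgf, hκ2] at key
  rw [cumulant_standardization hsmooth hint hm, abs_mul, abs_of_pos (by positivity),
    le_div_iff₀ (by have := hδ.1; positivity), mul_pow]
  set σ := stdDev X μ
  have hσm : σ⁻¹ ^ m * σ ^ (m - 2) * σ ^ 2 = 1 := by
    rw [mul_assoc, ← pow_add, Nat.sub_add_cancel hm, ← mul_pow, inv_mul_cancel₀ hσ.ne', one_pow]
  calc _ = σ⁻¹ ^ m * σ ^ (m - 2) *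
        (|iteratedDeriv m (cgf (fun ω => (X ω : ℝ)) μ) 0| * (1 / 4 * δ) ^ (m - 2)) := by ring
    _ ≤ σ⁻¹ ^ m * σ ^ (m - 2) * (m.factorial * σ ^ 2) := by gcongr
    _ = m.factorial * (σ⁻¹ ^ m * σ ^ (m - 2) * σ ^ 2) := by ring
    _ = _ := by rw [hσm, mul_one]

end

theorem theorem2p1 :
    ∃ c : ℝ, 0 < c ∧ (2 : ℝ) ^ (-3248 : ℤ) ≤ c ∧
      ∀ (Ω : ℕ+ → Type*) [∀ N, MeasurableSpace (Ω N)]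
        (μ : ∀ N, Measure (Ω N)) [∀ N, IsProbabilityMeasure (μ N)]
        (X : ∀ N, Ω N → ℕ) (δ : ℕ+ → ℝ),
        (∀ N, Measurable (X N)) →
        (∀ N, ∃ n : ℕ, ∀ᵐ ω ∂(μ N), X N ω ≤ n) →
        (∀ N, 0 < variance (fun ω => (X N ω : ℝ)) (μ N)) →
        (∀ N, δ N ∈ Set.Ioo 0 Real.pi) →
        (∀ N, ∀ z ∈ sector (δ N), probGenFun (X N) (μ N) z ≠ 0) →
        ∀ (N : ℕ+) (m : ℕ), 3 ≤ m →
          |cumulant (standardization (X N) (μ N)) (μ N) m| ≤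
            (m.factorial : ℝ) / (c * δ N * stdDev (X N) (μ N)) ^ (m - 2) := by
  refine ⟨1 / 4, by norm_num, ?_, ?_⟩
  · calc (2 : ℝ) ^ (-3248 : ℤ) ≤ 2 ^ (-2 : ℤ) := zpow_le_zpow_right₀ one_le_two (by norm_num)
      _ = 1 / 4 := by norm_num
  · intro Ω _ μ _ X δ hX hn hvar hδ hz N m hm
    exact abs_cumulant_standardization_le (hX N) (hn N) (hvar N) (hδ N) (hz N) (by omega)
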